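/- Let $R$ be an associative unital ring. For a class $\mathcal C$ of right $R$-modules let $${}^{\perp_\infty}\mathcal C=\{M\in \mathrm{Mod}\text{-}R \mid \mathrm{Ext}^i_R(M,C)=0 \text{ for all } i\ge 1 \text{ and } C\in\mathcal C\}.$$ Let $\mathcal D={}^{\perp_\infty}\mathcal C$ for some class $\mathcal C$, and for right $R$-modules let $A\prec B$ mean that $A$ is a submodule of $B$ and $A, B, B/A\in\mathcal D$. Assume that $(\mathcal D,\prec)$ is an abstract elementary class (in the vocabulary of right $R$-modules); such pairs are called AECs of roots of Ext. Let $\rho=\mathrm{LS}(\mathcal D)$ be its Löwenheim–Skolem number, i.e. the least infinite cardinal $\kappa\geq \mathrm{card}\,R$ such that for each $B\in\mathcal D$ and each submodule $A$ of $B$ there is $A'\in\mathcal D$ with $A\subseteq A'\prec B$ and $|A'|\leq |A|+\kappa$. For an infinite cardinal $\lambda$, call $\mathcal D$ categorical in $\lambda$ if $\mathcal D$ contains a module of cardinality $\lambda$ and all modules in $\mathcal D$ of cardinality $\lambda$ are isomorphic. Let $\mathcal P_0$ be the class of all projective right $R$-modules. Theorem 2.3. Shelah's Categoricity Conjecture holds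 for $(\mathcal D,\prec)$: if $\mathcal D$ is categorical in some cardinal $\lambda\geq\beth_{(2^\rho)^+}$, then $\mathcal D$ is categorical in all cardinals $\geq\beth_{(2^\rho)^+}$. In fact, this holds in the stronger form with threshold $\rho^+$: if $\mathcal D$ is categorical in some cardinal $\lambda\geq\rho^+$, then $\mathcal D$ is categorical in all cardinals $\geq\rho^+$. More precisely, one of the following holds: 1. $\mathcal D$ contains a non-projective module, and $\mathcal D$ is categorical in no cardinal $\lambda\geq\rho$; 2. $\mathcal D=\mathcal P_0$, the ring $R$ is right perfect (every right $R$-module has a projective cover), and if $\mathcal D$ is categorical in some cardinal $\lambda\geq\rho$, then it is categorical in every cardinal $\geq\rho^+$. -/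

import Mathlib

open CategoryTheory Cardinal

universe u

/-- Unitary right modules over the ring `R`, i.e. modules over the opposite ring. -/
abbrev RightMod (R : Type u) [Ring R] : Type (u + 1) := ModuleCat.{u} Rᵐᵒᵖ

namespace RightMod

variable {R : Type u} [Ring R]

/-- A submodule `N` of the right module `M`, regarded as a right module. -/
abbrev sub {M : RightMod R} (N : Submodule Rᵐᵒᵖ M) : RightMod R := ModuleCat.of Rᵐᵒᵖ N

/-- The quotient module `M / N`. -/
abbrev quot {M : RightMod R} (N : Submodule Rᵐᵒᵖ M) : RightMod R := ModuleCat.of Rᵐᵒᵖ (M ⧸ N)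

/-- A relation `A ≺ B` which implies that `A` is a substructure (here: a submodule) of `B`, given
as a predicate on the submodules of each module. -/
abbrev SubRel (R : Type u) [Ring R] : Type (u + 1) :=
  ∀ M : RightMod R, Submodule Rᵐᵒᵖ M → Prop

/-- For two submodules `A`, `B` of a common module: `A` is a submodule of `B` and `A ≺ B`. -/
def SubRel.Rel (prec : SubRel R) {M : RightMod R} (A B : Submodule Rᵐᵒᵖ M) : Prop :=
  A ≤ B ∧ prec (sub B) (A.submoduleOf B)

/-- `(A i | i < δ)` is a continuous `≺`-increasing chain of elements of `𝒜`. All the members of the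
chain are taken as submodules of one module `M` (one can always take `M` to be the union of the
chain). The suprema below are unions, because the chain is increasing. -/
structure IsContinuousChain (𝒜 : Set (RightMod R)) (prec : SubRel R) {M : RightMod R}
    (δ : Ordinal.{u}) (A : Ordinal.{u} → Submodule Rᵐᵒᵖ M) : Prop where
  mem : ∀ i < δ, sub (A i) ∈ 𝒜
  succ : ∀ i, Order.succ i < δ → prec.Rel (A i) (A (Order.succ i))
  limit : ∀ i < δ, Order.IsSuccLimit i → A i = ⨆ j, ⨆ _ : j < i, A j

/-- The Löwenheim-Skolem property of `(𝒜, ≺)` at the cardinal `κ`. -/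
def LSProperty (𝒜 : Set (RightMod R)) (prec : SubRel R) (κ : Cardinal.{u}) : Prop :=
  ∀ B ∈ 𝒜, ∀ A : Submodule Rᵐᵒᵖ B, ∃ A' : Submodule Rᵐᵒᵖ B,
    sub A' ∈ 𝒜 ∧ A ≤ A' ∧ prec B A' ∧ #A' ≤ #A + κ

/-- `(𝒜, ≺)` is an abstract elementary class of right `R`-modules. The vocabulary is that of right
`R`-modules, so substructures are submodules, and the axiom that `A ≺ B` implies that `A` is a
substructure of `B` is built into the type of `≺`. For the same reason `≺` is antisymmetric. -/
structure IsAEC (𝒜 : Set (RightMod R)) (prec : SubRel R) : Prop where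
  /-- `𝒜` is closed under isomorphisms. -/
  iso_mem : ∀ M N : RightMod R, Nonempty (M ≃ₗ[Rᵐᵒᵖ] N) → M ∈ 𝒜 → N ∈ 𝒜
  /-- `≺` is closed under isomorphisms. -/
  iso_prec : ∀ (M M' : RightMod R) (f : M ≃ₗ[Rᵐᵒᵖ] M') (N : Submodule Rᵐᵒᵖ M),
    prec M N → prec M' (N.map f.toLinearMap)
  /-- `≺` is a relation on `𝒜`. -/
  prec_mem : ∀ (M : RightMod R) (N : Submodule Rᵐᵒᵖ M), prec M N → sub N ∈ 𝒜 ∧ M ∈ 𝒜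
  /-- `≺` is reflexive on `𝒜`. -/
  prec_refl : ∀ M ∈ 𝒜, prec M ⊤
  /-- `≺` is transitive. -/
  prec_trans : ∀ (M : RightMod R) (A B : Submodule Rᵐᵒᵖ M), prec.Rel A B → prec M B → prec M A
  /-- The union of a continuous `≺`-increasing chain belongs to `𝒜`. -/
  union_mem : ∀ (M : RightMod R) (δ : Ordinal.{u}) (A : Ordinal.{u} → Submodule Rᵐᵒᵖ M), 0 < δ →
    IsContinuousChain 𝒜 prec δ A → sub (⨆ i, ⨆ _ : i < δ, A i) ∈ 𝒜
  /-- Each member of a continuous `≺`-increasing chain is `≺` the union. -/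
  prec_union : ∀ (M : RightMod R) (δ : Ordinal.{u}) (A : Ordinal.{u} → Submodule Rᵐᵒᵖ M), 0 < δ →
    IsContinuousChain 𝒜 prec δ A → ∀ j < δ, prec.Rel (A j) (⨆ i, ⨆ _ : i < δ, A i)
  /-- If all members of a continuous `≺`-increasing chain are `≺ M`, then so is the union. -/
  union_prec : ∀ (M : RightMod R) (δ : Ordinal.{u}) (A : Ordinal.{u} → Submodule Rᵐᵒᵖ M), 0 < δ →
    IsContinuousChain 𝒜 prec δ A → M ∈ 𝒜 → (∀ i < δ, prec M (A i)) →
      prec M (⨆ i, ⨆ _ : i < δ, A i)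
  /-- Coherence. -/
  coherence : ∀ (M : RightMod R) (A B : Submodule Rᵐᵒᵖ M),
    prec M A → prec M B → A ≤ B → prec.Rel A B
  /-- The Löwenheim-Skolem axiom. -/
  exists_LS : ∃ κ : Cardinal.{u}, LSProperty 𝒜 prec κ

/-- The Löwenheim-Skolem number: the least infinite cardinal `κ`, at least the cardinality of the
vocabulary, with the Löwenheim-Skolem property. The vocabulary of right `R`-modules has
`card R` symbols up to finitely many, so an infinite `κ` bounds it iff `card R ≤ κ`. -/
noncomputable def LSNumber (𝒜 : Set (RightMod R)) (prec : SubRel R) : Cardinal.{u} :=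
  sInf {κ | ℵ₀ ≤ κ ∧ #R ≤ κ ∧ LSProperty 𝒜 prec κ}

/-- The class of all `M` with `Ext^i_R (M, C) = 0` for all `i ≥ 1` and all `C ∈ 𝒞`. -/
def perpInfty (𝒞 : Set (RightMod R)) : Set (RightMod R) :=
  {M | ∀ C ∈ 𝒞, ∀ i : ℕ, 1 ≤ i → Subsingleton (Abelian.Ext M C i)}

/-- `A ≺ B` iff `A` is a submodule of `B` such that `A`, `B` and `B / A` are in `𝒜`. -/
def extPrec (𝒜 : Set (RightMod R)) : SubRel R :=
  fun B A => sub A ∈ 𝒜 ∧ B ∈ 𝒜 ∧ quot A ∈ 𝒜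

/-- `(𝒟, ≺)` is an abstract elementary class of roots of Ext. -/
def IsAECOfRootsOfExt (𝒟 : Set (RightMod R)) (prec : SubRel R) : Prop :=
  (∃ 𝒞 : Set (RightMod R), 𝒟 = perpInfty 𝒞) ∧ prec = extPrec 𝒟 ∧ IsAEC 𝒟 prec

/-- `𝒟` is categorical in the infinite cardinal `μ`: it contains a module of cardinality `μ`, and
all its modules of cardinality `μ` are isomorphic. -/
def IsCategoricalIn (𝒟 : Set (RightMod R)) (μ : Cardinal.{u}) : Prop :=
  ℵ₀ ≤ μ ∧ (∃ M ∈ 𝒟, #M = μ) ∧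
    ∀ M ∈ 𝒟, ∀ N ∈ 𝒟, #M = μ → #N = μ → Nonempty (M ≃ₗ[Rᵐᵒᵖ] N)

/-- Categoricity in some cardinal `≥ θ` implies categoricity in all cardinals `≥ θ`. -/
def CategoricityTransfer (𝒟 : Set (RightMod R)) (θ : Cardinal.{u}) : Prop :=
  (∃ μ, θ ≤ μ ∧ IsCategoricalIn 𝒟 μ) → ∀ μ, θ ≤ μ → IsCategoricalIn 𝒟 μ

/-- Shelah's Categoricity Conjecture for `(𝒜, ≺)`: categoricity transfer with the threshold
`ℶ_ ((2 ^ κ)⁺)`, where `κ` is the Löwenheim-Skolem number. -/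
def SCC (𝒜 : Set (RightMod R)) (prec : SubRel R) : Prop :=
  CategoricityTransfer 𝒜 (ℶ_ (Order.succ ((2 : Cardinal.{u}) ^ LSNumber 𝒜 prec)).ord)

/-- The class `𝒫₀` of all projective right `R`-modules. -/
def projectives (R : Type u) [Ring R] : Set (RightMod R) :=
  {M | Module.Projective Rᵐᵒᵖ M}

/-- `R` is right perfect: each right `R`-module `M` has a projective cover, that is, an epimorphism
`P → M` from a projective module with superfluous kernel. -/
def IsRightPerfect (R : Type u) [Ring R] : Prop :=
  ∀ M : RightMod R, ∃ P ∈ projectives R, ∃ f : P →ₗ[Rᵐᵒᵖ] M, Function.Surjective f ∧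
    ∀ N : Submodule Rᵐᵒᵖ P, N ⊔ LinearMap.ker f = ⊤ → N = ⊤

end RightMod

/-!
Write `ρ` for the Löwenheim-Skolem number. The class `𝒟` contains the projective modules and is
closed under finite direct sums, because it is defined by the vanishing of `Ext`.

If all modules of cardinality at most `ρ` in `𝒟` are projective, then so are all modules in `𝒟`
(`RightMod.IsAEC.projective_of_forall_small`): each module in `𝒟` is exhausted by a chain of
submodules whose successive quotients are small and in `𝒟`. Otherwise `𝒟` contains a small
non-projective module `N`. For each infinite `μ ≥ ρ`, a free module `F` of cardinality `μ` and the
module `N × F` are then two non-isomorphic members of `𝒟` of cardinality `μ`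
(`RightMod.not_isCategoricalIn_of_not_projective`), so there is no categoricity at all.

There remains the case that `𝒟` is the class of all projective modules. Then the AEC axioms say that
the submodules `A` of a projective module `F` with `F / A` projective, i.e. the direct summands of
`F`, are closed under unions of chains (`RightMod.IsAEC.summandsClosedUnderChains`). From this
property, everything follows by ring theory, which is done for left modules over `S = Rᵐᵒᵖ` with
Jacobson radical `J`:
* Bass modules are projective. So `S` has the descending chain condition on principal right ideals,
  `J` is T-nilpotent (`SummandsClosedUnderChains.exists_prod_eq_zero`), and hence `J • P` is
  superfluous in every module `P`
  (`SummandsClosedUnderChains.eq_top_of_sup_jacobson_smul_eq_top`).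
* Each principal right ideal outside `J` contains a nonzero idempotent. So each submodule `K` of a
  projective module `P` with `K` not contained in `J • P` contains a nonzero direct summand of `P`;
  dividing by a maximal direct summand contained in `K`, one reaches the case `K ≤ J • P`
  (`SummandsClosedUnderChains.exists_le_sup_jacobson`). Applied to the kernel of a presentation, this
  yields projective covers, so `R` is right perfect; it also shows that `P / J • P` is semisimple.
* Projective modules `P` are determined up to isomorphism by `P / J • P`. If there is categoricity in
  some `κ ≥ ρ`, then there is only one simple module `T` up to isomorphism
  (`SummandsClosedUnderChains.nonempty_linearEquiv_of_isSimpleModule`). So `P / J • P` is a direct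
  sum of copies of `T`, and when `#P > ρ` the number of copies has to be `#P`.
-/

/-! ### Bass modules and chain conditions -/

section Bass

variable {S : Type u} [Ring S]

/-- The submodules `A` of projective modules `F` with `F / A` projective, i.e. the direct summands
of projective modules, are closed under unions of nonempty chains. -/
def SummandsClosedUnderChains (S : Type u) [Ring S] : Prop :=
  ∀ (F : Type u) [AddCommGroup F] [Module S F] [Module.Projective S F] (c : Set (Submodule S F)),
    c.Nonempty → IsChain (· ≤ ·) c → (∀ A ∈ c, Module.Projective S (F ⧸ A)) →
      Module.Projective S (F ⧸ sSup c)

/-- If an endomorphism `p` of a projective module vanishes on `A` and is the identity modulo `A`,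
then it embeds the quotient by `A` as a direct summand. -/
lemma Module.Projective.quotient_of_endomorphism {F : Type u} [AddCommGroup F] [Module S F]
    [Module.Projective S F] (A : Submodule S F) (p : F →ₗ[S] F) (hA : ∀ y ∈ A, p y = 0)
    (hp : ∀ y, p y - y ∈ A) : Module.Projective S (F ⧸ A) := by
  refine Module.Projective.of_split (A.liftQ p fun y hy ↦ hA y hy) A.mkQ ?_
  ext y
  exact (Submodule.Quotient.eq A).2 (hp y)

/-- The relation `e n - a n • e (n + 1)` of the Bass module of the sequence `a`, in the free module
with basis `e 0, e 1, …`. -/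
noncomputable def bassRelation (a : ℕ → S) (n : ℕ) : ℕ →₀ S :=
  Finsupp.single n 1 - Finsupp.single (n + 1) (a n)

/-- The projection modulo the first `n` Bass relations, which sends `e k` to
`a k * ⋯ * a (n - 1) • e n` for `k < n` and fixes `e k` for `k ≥ n`. -/
noncomputable def bassProjection (a : ℕ → S) : ℕ → ((ℕ →₀ S) →ₗ[S] (ℕ →₀ S))
  | 0 => LinearMap.id
  | n + 1 => (LinearMap.id - (Finsupp.lapply n).smulRight (bassRelation a n)) ∘ₗ bassProjection a n

/-- The functional sending `e k` to `a k * ⋯ * a (l - 1)` for `k ≤ l` and to `0` for `k > l`.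
It vanishes on the first `l` Bass relations. -/
noncomputable def bassFunctional (a : ℕ → S) : ℕ → ((ℕ →₀ S) →ₗ[S] S)
  | 0 => Finsupp.lapply 0
  | l + 1 => LinearMap.toSpanSingleton S S (a l) ∘ₗ bassFunctional a l + Finsupp.lapply (l + 1)

lemma bassProjection_succ_apply (a : ℕ → S) (n : ℕ) (y : ℕ →₀ S) :
    bassProjection a (n + 1) y =
      bassProjection a n y - (bassProjection a n y) n • bassRelation a n := rfl

lemma bassFunctional_succ_apply (a : ℕ → S) (l : ℕ) (y : ℕ →₀ S) :
    bassFunctional a (l + 1) y = bassFunctional a l y * a l + y (l + 1) := rfl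

lemma bassProjection_of_forall_eq_zero (a : ℕ → S) (n : ℕ) {y : ℕ →₀ S}
    (hy : ∀ k < n, y k = 0) : bassProjection a n y = y := by
  induction n with
  | zero => rfl
  | succ n ih =>
    rw [bassProjection_succ_apply, ih fun k hk ↦ hy k (by omega), hy n (by omega)]
    simp

lemma bassRelation_apply_self (a : ℕ → S) (n : ℕ) : bassRelation a n n = 1 := by
  simp [bassRelation]

lemma bassRelation_apply_of_lt (a : ℕ → S) {k n : ℕ} (h : k < n) : bassRelation a n k = 0 := by
  simp [bassRelation, show n ≠ k by omega, show n + 1 ≠ k by omega]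

lemma bassProjection_bassRelation (a : ℕ → S) {k n : ℕ} (h : k < n) :
    bassProjection a n (bassRelation a k) = 0 := by
  induction n with
  | zero => omega
  | succ n ih =>
    rw [bassProjection_succ_apply]
    obtain h | rfl := Nat.lt_succ_iff_lt_or_eq.1 h
    · simp [ih h]
    · rw [bassProjection_of_forall_eq_zero a k fun i hi ↦ bassRelation_apply_of_lt a hi,
        bassRelation_apply_self, one_smul, sub_self]

lemma bassProjection_sub_mem (a : ℕ → S) (n : ℕ) (y : ℕ →₀ S) :
    bassProjection a n y - y ∈ Submodule.span S (bassRelation a '' Set.Iio n) := by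
  induction n with
  | zero => simp [bassProjection]
  | succ n ih =>
    rw [bassProjection_succ_apply, sub_right_comm]
    refine sub_mem (Submodule.span_mono (Set.image_mono fun k hk ↦ ?_) ih)
      (Submodule.smul_mem _ _ (Submodule.subset_span ⟨n, by simp, rfl⟩))
    simp only [Set.mem_Iio] at *
    omega

lemma projective_quotient_span_bassRelation (a : ℕ → S) (n : ℕ) :
    Module.Projective S ((ℕ →₀ S) ⧸ Submodule.span S (bassRelation a '' Set.Iio n)) := by
  refine Module.Projective.quotient_of_endomorphism _ (bassProjection a n) (fun y hy ↦ ?_)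
    (bassProjection_sub_mem a n)
  have : Submodule.span S (bassRelation a '' Set.Iio n) ≤ LinearMap.ker (bassProjection a n) := by
    rw [Submodule.span_le]
    rintro _ ⟨k, hk, rfl⟩
    exact bassProjection_bassRelation a hk
  exact this hy

/-- The Bass module of any sequence is projective. -/
lemma SummandsClosedUnderChains.projective_bass (h : SummandsClosedUnderChains S) (a : ℕ → S) :
    Module.Projective S ((ℕ →₀ S) ⧸ Submodule.span S (Set.range (bassRelation a))) := by
  let G : ℕ → Submodule S (ℕ →₀ S) := fun n ↦ Submodule.span S (bassRelation a '' Set.Iio n)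
  have hG : Monotone G := fun m n hmn ↦
    Submodule.span_mono (Set.image_mono (Set.Iio_subset_Iio hmn))
  have hsup : sSup (Set.range G) = Submodule.span S (Set.range (bassRelation a)) := by
    refine le_antisymm (sSup_le ?_) (Submodule.span_le.2 ?_)
    · rintro _ ⟨n, rfl⟩
      exact Submodule.span_mono (Set.image_subset_range _ _)
    · rintro _ ⟨n, rfl⟩
      exact le_sSup (a := G (n + 1)) (Set.mem_range_self (n + 1))
        (Submodule.subset_span ⟨n, Nat.lt_succ_self n, rfl⟩)
  rw [← hsup]
  refine h _ _ (Set.range_nonempty G) hG.isChain_range ?_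
  rintro _ ⟨n, rfl⟩
  exact projective_quotient_span_bassRelation a n

lemma bassFunctional_single_of_lt (a : ℕ → S) {l n : ℕ} (h : l < n) (r : S) :
    bassFunctional a l (Finsupp.single n r) = 0 := by
  induction l with
  | zero => simp [bassFunctional, show n ≠ 0 by omega]
  | succ l ih =>
    rw [bassFunctional_succ_apply, ih (by omega)]
    simp [show n ≠ l + 1 by omega]

lemma bassFunctional_single_self (a : ℕ → S) (n : ℕ) (r : S) :
    bassFunctional a n (Finsupp.single n r) = r := by
  cases n with
  | zero => simp [bassFunctional]
  | succ n =>
    rw [bassFunctional_succ_apply, bassFunctional_single_of_lt a (Nat.lt_succ_self n)]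
    simp

lemma bassFunctional_single_zero (a : ℕ → S) (l : ℕ) :
    bassFunctional a l (Finsupp.single 0 1) = ((List.range l).map a).prod := by
  induction l with
  | zero => simp [bassFunctional]
  | succ l ih =>
    rw [bassFunctional_succ_apply, ih, List.prod_range_succ]
    simp

lemma bassFunctional_bassRelation (a : ℕ → S) {l n : ℕ} (h : n < l) :
    bassFunctional a l (bassRelation a n) = 0 := by
  induction l with
  | zero => omega
  | succ l ih =>
    rw [bassFunctional_succ_apply]
    obtain h | rfl := Nat.lt_succ_iff_lt_or_eq.1 h
    · rw [ih h]
      simp [bassRelation, show n ≠ l + 1 by omega, show n ≠ l by omega]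
    · rw [bassRelation, map_sub, bassFunctional_single_self,
        bassFunctional_single_of_lt a (Nat.lt_succ_self n)]
      simp

lemma exists_forall_bassFunctional_eq_zero (a : ℕ → S) {y : ℕ →₀ S}
    (hy : y ∈ Submodule.span S (Set.range (bassRelation a))) :
    ∃ L, ∀ l, L ≤ l → bassFunctional a l y = 0 := by
  induction hy using Submodule.span_induction with
  | mem x hx =>
    obtain ⟨n, rfl⟩ := hx
    exact ⟨n + 1, fun l hl ↦ bassFunctional_bassRelation a hl⟩
  | zero => exact ⟨0, fun l _ ↦ map_zero _⟩
  | add x y _ _ hx hy =>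
    obtain ⟨L, hL⟩ := hx
    obtain ⟨L', hL'⟩ := hy
    refine ⟨max L L', fun l hl ↦ ?_⟩
    rw [map_add, hL l (le_of_max_le_left hl), hL' l (le_of_max_le_right hl), add_zero]
  | smul r x _ hx =>
    obtain ⟨L, hL⟩ := hx
    exact ⟨L, fun l hl ↦ by rw [map_smul, hL l hl, smul_zero]⟩

/-- The descending chain of principal right ideals generated by the products `a 0 * ⋯ * a (l - 1)`
becomes stationary. A splitting of the Bass module yields elements `x n` with
`x n = a n • x (n + 1)` such that `e 0 - x 0` is in the span of the Bass relations; now apply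
`bassFunctional a l` for a large `l`. -/
lemma SummandsClosedUnderChains.exists_prod_eq (h : SummandsClosedUnderChains S) (a : ℕ → S) :
    ∃ l c, ((List.range l).map a).prod = ((List.range l).map a).prod * (a l * c) := by
  set G := Submodule.span S (Set.range (bassRelation a)) with hG
  have := h.projective_bass a
  obtain ⟨s, hs⟩ := G.mkQ.exists_rightInverse_of_surjective G.range_mkQ
  let x : ℕ → (ℕ →₀ S) := fun n ↦ s (G.mkQ (Finsupp.single n 1))
  have hx : ∀ n, x n = a n • x (n + 1) := fun n ↦ by
    simp only [x, ← map_smul]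
    congr 1
    refine (Submodule.Quotient.eq G).2 (Submodule.subset_span ⟨n, ?_⟩)
    simp [bassRelation]
  have hx' : ∀ n, x 0 = ((List.range n).map a).prod • x n := fun n ↦ by
    induction n with
    | zero => simp
    | succ n ih => rw [ih, List.prod_range_succ, mul_smul, ← hx]
  have hmem : Finsupp.single 0 1 - x 0 ∈ G := by
    refine (Submodule.Quotient.eq G).1 ?_
    exact (LinearMap.congr_fun hs (G.mkQ (Finsupp.single 0 1))).symm
  obtain ⟨l, hl⟩ := exists_forall_bassFunctional_eq_zero a hmem
  have := hl l le_rfl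
  rw [map_sub, bassFunctional_single_zero, sub_eq_zero, hx' (l + 1), map_smul,
    List.prod_range_succ, smul_eq_mul, mul_assoc] at this
  exact ⟨l, _, this⟩

end Bass

/-! ### Idempotents and T-nilpotence of the Jacobson radical -/

section Jacobson

variable {S : Type u} [Ring S]

lemma Ring.mem_jacobson_iff_exists_mul_one_sub {r : S} :
    r ∈ Ring.jacobson S ↔ ∀ y, ∃ z, z * (1 - y * r) = 1 := by
  rw [← Ideal.jacobson_bot, Ideal.mem_jacobson_iff]
  refine ⟨fun h y ↦ ?_, fun h y ↦ ?_⟩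
  · obtain ⟨z, hz⟩ := h (-y)
    refine ⟨z, ?_⟩
    rw [Ideal.mem_bot] at hz
    rw [← sub_eq_zero, ← hz]
    noncomm_ring
  · obtain ⟨z, hz⟩ := h (-y)
    refine ⟨z, ?_⟩
    rw [Ideal.mem_bot, ← sub_eq_zero.2 hz]
    noncomm_ring

lemma Ring.isUnit_one_sub_of_mem_jacobson {r : S} (hr : r ∈ Ring.jacobson S) :
    IsUnit (1 - r) := by
  obtain ⟨z, hz⟩ := mem_jacobson_iff_exists_mul_one_sub.1 hr 1
  obtain ⟨w, hw⟩ := mem_jacobson_iff_exists_mul_one_sub.1 hr (-z)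
  rw [one_mul] at hz
  have hw' : w * z = 1 := by
    rw [← hw]
    congr 1
    rw [← sub_eq_zero, ← sub_eq_zero.2 hz]
    noncomm_ring
  exact isUnit_iff_exists.2 ⟨z, by rwa [← left_inv_eq_right_inv hw' hz], hz⟩

/-- The Jacobson radical is T-nilpotent. -/
lemma SummandsClosedUnderChains.exists_prod_eq_zero (h : SummandsClosedUnderChains S) (a : ℕ → S)
    (ha : ∀ n, a n ∈ Ring.jacobson S) : ∃ l, ((List.range l).map a).prod = 0 := by
  obtain ⟨l, c, hl⟩ := h.exists_prod_eq a
  refine ⟨l, ?_⟩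
  have hu := Ring.isUnit_one_sub_of_mem_jacobson (Ideal.mul_mem_right c _ (ha l))
  rw [← hu.mul_left_eq_zero, mul_sub, mul_one, sub_eq_zero]
  exact hl

/-- The descending chain condition on principal right ideals. -/
lemma SummandsClosedUnderChains.wellFounded (h : SummandsClosedUnderChains S) :
    WellFounded fun b a : S ↦ (∃ c, b = a * c) ∧ ¬ ∃ d, a = b * d := by
  rw [wellFounded_iff_isEmpty_descending_chain]
  refine ⟨fun ⟨f, hf⟩ ↦ ?_⟩
  choose a ha using fun n ↦ (hf n).1
  have hprod : ∀ n, f n = f 0 * ((List.range n).map a).prod := fun n ↦ by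
    induction n with
    | zero => simp
    | succ n ih => rw [ha, ih, List.prod_range_succ, mul_assoc]
  obtain ⟨l, c, hl⟩ := h.exists_prod_eq a
  refine (hf l).2 ⟨c, ?_⟩
  rw [hprod (l + 1), hprod l, List.prod_range_succ, mul_assoc, mul_assoc, ← hl]

lemma Ring.mem_jacobson_of_forall_mul_mul_mem {a : S} (h : ∀ x, a * x * a ∈ Ring.jacobson S) :
    a ∈ Ring.jacobson S := by
  rw [mem_jacobson_iff_exists_mul_one_sub]
  intro y
  obtain ⟨z, hz⟩ := mem_jacobson_iff_exists_mul_one_sub.1 (h y) y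
  refine ⟨z * (1 + y * a), ?_⟩
  refine Eq.trans ?_ hz
  rw [mul_assoc]
  congr 1
  noncomm_ring

/-- Every principal right ideal outside the Jacobson radical contains a nonzero idempotent. -/
lemma SummandsClosedUnderChains.exists_isIdempotentElem (h : SummandsClosedUnderChains S) {r : S}
    (hr : r ∉ Ring.jacobson S) : ∃ t, IsIdempotentElem (r * t) ∧ r * t ≠ 0 := by
  obtain ⟨a, ⟨⟨r', rfl⟩, haJ⟩, hmin⟩ :=
    h.wellFounded.has_min {a | (∃ t, a = r * t) ∧ a ∉ Ring.jacobson S} ⟨r, ⟨1, by simp⟩, hr⟩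
  set a := r * r' with ha
  -- Any element of `a * S` outside the radical generates `a * S`.
  have hgen : ∀ c, a * c ∉ Ring.jacobson S → ∃ d, a = a * c * d := fun c hc ↦ by
    by_contra hd
    exact hmin (a * c) ⟨⟨r' * c, by rw [ha, mul_assoc]⟩, hc⟩ ⟨⟨c, rfl⟩, hd⟩
  obtain ⟨x, hx⟩ : ∃ x, a * x * a ∉ Ring.jacobson S := by
    by_contra! hx
    exact haJ (Ring.mem_jacobson_of_forall_mul_mul_mem hx)
  obtain ⟨d, hd⟩ := hgen (x * a) (by rwa [← mul_assoc])
  -- Left multiplication by `a * x` maps `a * S` onto itself, and `a * (d * x)` to `a * x`.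
  set e := a * (d * x) with he
  have hue : a * x * e = a * x := by
    rw [he]
    conv_rhs => rw [hd]
    simp only [mul_assoc]
  have heJ : e ∉ Ring.jacobson S := fun heJ ↦ hx <| by
    rw [← hue]
    exact Ideal.mul_mem_right _ _ (Ideal.mul_mem_left _ _ heJ)
  have hee : e * e - e ∈ Ring.jacobson S := by
    by_contra hee
    have h1 : e * e - e = a * (d * x * e - d * x) := by
      rw [mul_sub, ← mul_assoc a, ← he]
    rw [h1] at hee
    obtain ⟨c, hc⟩ := hgen _ hee
    refine hx ?_
    have h2 : a * x * (e * e - e) = 0 := by rw [mul_sub, ← mul_assoc, hue, hue, sub_self]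
    have h3 : a * x * a = a * x * ((e * e - e) * c) := by rw [h1, ← hc]
    rw [h3, ← mul_assoc, h2, zero_mul]
    exact zero_mem _
  obtain ⟨n, hn⟩ := h.exists_prod_eq_zero (fun _ ↦ e - e ^ 2) fun _ ↦ by
    rw [← neg_mem_iff, neg_sub, sq]
    exact hee
  rw [List.map_const', List.prod_replicate, List.length_range] at hn
  have hn' : (e - e ^ 2) ^ (n + 1) = 0 := by rw [pow_succ, hn, zero_mul]
  have hidem := isIdempotentElem_one_sub_one_sub_pow_pow e (n + 1) hn'
  have hfac : 1 - (1 - e ^ (n + 1)) ^ (n + 1) =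
      r * (r' * (d * x) * e ^ n * ∑ i ∈ Finset.range (n + 1), (1 - e ^ (n + 1)) ^ i) := by
    rw [← mul_neg_geom_sum, sub_sub_cancel, pow_succ', he, ha]
    simp only [mul_assoc]
  refine ⟨_, hfac ▸ hidem, hfac ▸ fun h0 ↦ heJ ?_⟩
  have hq : IsIdempotentElem (Ideal.Quotient.mk (Ring.jacobson S) e) := by
    rw [IsIdempotentElem, ← map_mul]
    exact Ideal.Quotient.eq.2 hee
  have := congrArg (Ideal.Quotient.mk (Ring.jacobson S)) h0
  rw [map_sub, map_pow, map_sub, map_pow, map_one, map_zero, hq.pow_succ_eq,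
    hq.one_sub.pow_succ_eq, sub_sub_cancel] at this
  exact Ideal.Quotient.eq_zero_iff_mem.1 this

/-- Nakayama's lemma for a T-nilpotent radical, without finiteness assumptions. -/
lemma SummandsClosedUnderChains.subsingleton_of_jacobson_smul_eq_top
    (h : SummandsClosedUnderChains S) {M : Type*} [AddCommGroup M] [Module S M]
    (hM : Ring.jacobson S • (⊤ : Submodule S M) = ⊤) : Subsingleton M := by
  by_contra hne
  rw [not_subsingleton_iff_nontrivial] at hne
  have step : ∀ b : {b : S // ∃ m : M, b • m ≠ 0}, ∃ j ∈ Ring.jacobson S,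
      ∃ m : M, (b.1 * j) • m ≠ 0 := by
    rintro ⟨b, m, hm⟩
    by_contra! hb
    replace hb : ∀ j ∈ Ring.jacobson S, ∀ n : M, (b * j) • n = 0 := hb
    refine hm ?_
    clear hm
    have hmem : m ∈ Ring.jacobson S • (⊤ : Submodule S M) := by rw [hM]; trivial
    induction hmem using Submodule.smul_induction_on' with
    | smul r hr n _ => rw [← mul_smul, hb r hr n]
    | add x _ y _ hx hy =>
      rw [smul_add, hx, hy, add_zero]
  choose j hj hj' using step
  obtain ⟨m, hm⟩ := exists_ne (0 : M)
  let f : ℕ → {b : S // ∃ m : M, b • m ≠ 0} :=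
    Nat.rec ⟨1, m, by simpa using hm⟩ fun _ b ↦ ⟨b.1 * j b, hj' b⟩
  have hf : ∀ n, (f n).1 = ((List.range n).map fun i ↦ j (f i)).prod := fun n ↦ by
    induction n with
    | zero => simp [f]
    | succ n ih => rw [List.prod_range_succ, ← ih]
  obtain ⟨l, hl⟩ := h.exists_prod_eq_zero (fun i ↦ j (f i)) fun i ↦ hj _
  obtain ⟨m, hm⟩ := (f l).2
  rw [hf, hl, zero_smul] at hm
  exact hm rfl

lemma SummandsClosedUnderChains.eq_top_of_sup_jacobson_smul_eq_top
    (h : SummandsClosedUnderChains S) {M : Type*} [AddCommGroup M] [Module S M]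
    {N : Submodule S M} (hN : N ⊔ Ring.jacobson S • (⊤ : Submodule S M) = ⊤) : N = ⊤ := by
  rw [← Submodule.Quotient.subsingleton_iff]
  refine h.subsingleton_of_jacobson_smul_eq_top ?_
  have := congrArg (Submodule.map N.mkQ) hN
  rwa [Submodule.map_sup, Submodule.map_smul'', N.mkQ_map_self, bot_sup_eq, Submodule.map_top,
    N.range_mkQ] at this

end Jacobson

/-! ### Projective modules over a ring with summands closed under chains -/

lemma Cardinal.mk_finsupp_le_max (α β : Type u) [Zero β] : #(α →₀ β) ≤ max (max ℵ₀ #β) #α := by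
  refine (mk_le_of_injective (Finsupp.graph_injective α β)).trans ?_
  cases finite_or_infinite (α × β) with
  | inl _ => exact mk_le_aleph0.trans ((le_max_left _ _).trans (le_max_left _ _))
  | inr _ =>
    rw [mk_finset_of_infinite, mk_prod, lift_id, lift_id]
    refine (mul_le_max _ _).trans (le_of_eq ?_)
    ac_rfl

section Projective

variable {S : Type u} [Ring S]

lemma Module.Projective.quotient_comap_mkQ {F : Type u} [AddCommGroup F] [Module S F]
    {A : Submodule S F} {C : Submodule S (F ⧸ A)} (h : Module.Projective S ((F ⧸ A) ⧸ C)) :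
    Module.Projective S (F ⧸ C.comap A.mkQ) := by
  have e := Submodule.quotientQuotientEquivQuotient A (C.comap A.mkQ) (A.le_comap_mkQ C)
  rw [Submodule.map_comap_eq_of_surjective A.mkQ_surjective] at e
  exact Module.Projective.of_equiv e

lemma Submodule.exists_isCompl_of_projective_quotient {F : Type u} [AddCommGroup F] [Module S F]
    (A : Submodule S F) [Module.Projective S (F ⧸ A)] : ∃ B, IsCompl A B := by
  obtain ⟨s, hs⟩ := A.mkQ.exists_rightInverse_of_surjective A.range_mkQ
  have hs' : ∀ q, A.mkQ (s q) = q := LinearMap.congr_fun hs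
  refine ⟨LinearMap.range s, Submodule.disjoint_def.2 ?_,
    codisjoint_iff.2 (top_unique fun x _ ↦ ?_)⟩
  · rintro _ hx ⟨q, rfl⟩
    rw [← hs' q, show A.mkQ (s q) = 0 from (Submodule.Quotient.mk_eq_zero A).2 hx, map_zero]
  · rw [← sub_add_cancel x (s (A.mkQ x))]
    refine Submodule.add_mem_sup ?_ ⟨_, rfl⟩
    refine A.ker_mkQ.le ?_
    rw [LinearMap.mem_ker, map_sub, hs', sub_self]

/-- In a projective module, a submodule not contained in the radical contains a nonzero direct
summand: some functional sends an `x` in `K` outside the radical of the ring, and then multiplying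
by suitable elements produces an idempotent endomorphism with range in `K`. -/
lemma SummandsClosedUnderChains.exists_summand_le (h : SummandsClosedUnderChains S) {P : Type u}
    [AddCommGroup P] [Module S P] [Module.Projective S P] {K : Submodule S P} {x : P}
    (hxK : x ∈ K) (hx : x ∉ Ring.jacobson S • (⊤ : Submodule S P)) :
    ∃ C ≤ K, C ≠ ⊥ ∧ Module.Projective S (P ⧸ C) := by
  obtain ⟨s, hs⟩ := Module.projective_def'.1 ‹Module.Projective S P›
  obtain ⟨i, hi⟩ : ∃ i, s x i ∉ Ring.jacobson S := by
    by_contra! hJ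
    refine hx ?_
    rw [← LinearMap.id_apply (R := S) x, ← hs, LinearMap.comp_apply,
      Finsupp.linearCombination_apply]
    exact Submodule.sum_mem _ fun i _ ↦ Submodule.smul_mem_smul (hJ i) trivial
  obtain ⟨t, hidem, hne⟩ := h.exists_isIdempotentElem hi
  set f := s x i * t with hf
  let g : P →ₗ[S] S := LinearMap.toSpanSingleton S S t ∘ₗ Finsupp.lapply i ∘ₗ s
  have hg : g x = f := rfl
  let θ : P →ₗ[S] P := g.smulRight (f • x)
  have hθ : ∀ z, θ z = g z • f • x := fun z ↦ rfl
  have hgy : g (f • x) = f := by rw [map_smul, hg, smul_eq_mul, hidem.eq]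
  have hθθ : ∀ z, θ (θ z) = θ z := fun z ↦ by
    rw [hθ z, map_smul, hθ, hgy, ← mul_smul f f, hidem.eq]
  refine ⟨LinearMap.range θ, ?_, fun h0 ↦ hne ?_,
    Module.Projective.quotient_of_endomorphism _ (LinearMap.id - θ) ?_ fun y ↦ ?_⟩
  · rintro _ ⟨z, rfl⟩
    exact K.smul_mem _ (K.smul_mem _ hxK)
  · have h1 : θ (f • x) = 0 := by
      rw [LinearMap.range_eq_bot.1 h0, LinearMap.zero_apply]
    rw [hθ, hgy, ← mul_smul, hidem.eq] at h1
    rw [← hgy, h1, map_zero]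
  · rintro _ ⟨z, rfl⟩
    rw [LinearMap.sub_apply, hθθ, LinearMap.id_apply, sub_self]
  · exact ⟨-y, by simp⟩

/-- Every submodule `K` of a projective module contains a direct summand which exhausts `K` modulo
the radical: take a maximal direct summand contained in `K`. -/
lemma SummandsClosedUnderChains.exists_le_sup_jacobson (h : SummandsClosedUnderChains S)
    {F : Type u} [AddCommGroup F] [Module S F] [Module.Projective S F] (K : Submodule S F) :
    ∃ A ≤ K, Module.Projective S (F ⧸ A) ∧ K ≤ A ⊔ Ring.jacobson S • ⊤ := by
  obtain ⟨A, -, ⟨hAK, hA⟩, hmax⟩ := zorn_le_nonempty₀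
    {A : Submodule S F | A ≤ K ∧ Module.Projective S (F ⧸ A)}
    (fun c hc hchain A hA ↦ ⟨sSup c, ⟨sSup_le fun B hB ↦ (hc hB).1,
      h F c ⟨A, hA⟩ hchain fun B hB ↦ (hc hB).2⟩, fun B hB ↦ le_sSup hB⟩) ⊥
    ⟨bot_le, Module.Projective.of_equiv (Submodule.quotEquivOfEqBot _ rfl).symm⟩
  refine ⟨A, hAK, hA, fun x hxK ↦ ?_⟩
  by_contra hx
  obtain ⟨C, hCK, hC, hPC⟩ := h.exists_summand_le (K := K.map A.mkQ) (x := A.mkQ x) ⟨x, hxK, rfl⟩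
    fun hxJ ↦ hx <| by
      rwa [← A.comap_map_mkQ, Submodule.mem_comap, Submodule.map_smul'', Submodule.map_top,
        A.range_mkQ]
  refine hC ?_
  have := hmax ⟨(Submodule.comap_mono hCK).trans (by rw [A.comap_map_mkQ, sup_of_le_right hAK]),
    hPC.quotient_comap_mkQ⟩ (A.le_comap_mkQ C)
  rw [← Submodule.map_comap_eq_of_surjective A.mkQ_surjective C, eq_bot_iff, ← A.mkQ_map_self]
  exact Submodule.map_mono this

lemma SummandsClosedUnderChains.exists_projective_cover (h : SummandsClosedUnderChains S)
    (M : Type u) [AddCommGroup M] [Module S M] :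
    ∃ (P : Type u) (_ : AddCommGroup P) (_ : Module S P) (_ : Module.Projective S P)
      (f : P →ₗ[S] M), Function.Surjective f ∧
        ∀ N : Submodule S P, N ⊔ LinearMap.ker f = ⊤ → N = ⊤ := by
  let g : (M →₀ S) →ₗ[S] M := Finsupp.linearCombination S id
  obtain ⟨A, hAK, hA, hK⟩ := h.exists_le_sup_jacobson (LinearMap.ker g)
  refine ⟨(M →₀ S) ⧸ A, inferInstance, inferInstance, hA, A.liftQ g hAK, ?_, fun N hN ↦ ?_⟩
  · rw [← LinearMap.range_eq_top, Submodule.range_liftQ, LinearMap.range_eq_top]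
    exact Finsupp.linearCombination_id_surjective S M
  · refine h.eq_top_of_sup_jacobson_smul_eq_top (top_unique (hN.ge.trans ?_))
    rw [Submodule.ker_liftQ]
    refine sup_le_sup_left ((Submodule.map_mono hK).trans ?_) N
    rw [Submodule.map_sup, A.mkQ_map_self, bot_sup_eq, Submodule.map_smul'']
    exact Submodule.smul_mono le_rfl le_top

/-- Projective modules are semisimple modulo their radicals. -/
lemma SummandsClosedUnderChains.isSemisimpleModule_quotient (h : SummandsClosedUnderChains S)
    (P : Type u) [AddCommGroup P] [Module S P] [Module.Projective S P] :
    IsSemisimpleModule S (P ⧸ Ring.jacobson S • (⊤ : Submodule S P)) := by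
  set J := Ring.jacobson S • (⊤ : Submodule S P) with hJ
  refine { exists_isCompl := fun K' ↦ ?_ }
  obtain ⟨A, hAK, hA, hK⟩ := h.exists_le_sup_jacobson (K'.comap J.mkQ)
  obtain ⟨B, hAB⟩ := A.exists_isCompl_of_projective_quotient
  have hK' : K' = A.map J.mkQ := by
    rw [← Submodule.map_comap_eq_of_surjective J.mkQ_surjective K']
    refine le_antisymm ((Submodule.map_mono hK).trans ?_) (Submodule.map_mono hAK)
    rw [← hJ, Submodule.map_sup, J.mkQ_map_self, sup_bot_eq]
  refine ⟨B.map J.mkQ, ?_, ?_⟩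
  · rw [hK', Submodule.disjoint_def]
    rintro _ ⟨a, ha, rfl⟩ ⟨b, hb, hba⟩
    -- The projection onto `A` along `B` preserves the radical.
    let p : P →ₗ[S] P := A.projection B hAB
    have hpJ : J.map p ≤ J := by
      rw [hJ, Submodule.map_smul'']
      exact Submodule.smul_mono le_rfl le_top
    have hmem : b - a ∈ J := (Submodule.Quotient.eq J).1 hba
    have := hpJ ⟨_, hmem, rfl⟩
    rw [map_sub, (Submodule.projection_apply_eq_zero_iff hAB).2 hb,
      Submodule.projection_apply_of_mem_left hAB ha, zero_sub, neg_mem_iff] at this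
    exact (Submodule.Quotient.mk_eq_zero J).2 this
  · rw [hK', codisjoint_iff, ← Submodule.map_sup, hAB.sup_eq_top, Submodule.map_top, J.range_mkQ]

/-- Projective modules are determined by their quotients modulo the radical. -/
lemma SummandsClosedUnderChains.nonempty_linearEquiv (h : SummandsClosedUnderChains S)
    {P Q : Type u} [AddCommGroup P] [Module S P] [Module.Projective S P]
    [AddCommGroup Q] [Module S Q] [Module.Projective S Q]
    (e : (P ⧸ Ring.jacobson S • (⊤ : Submodule S P)) ≃ₗ[S]
      (Q ⧸ Ring.jacobson S • (⊤ : Submodule S Q))) : Nonempty (P ≃ₗ[S] Q) := by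
  set J := Ring.jacobson S • (⊤ : Submodule S P) with hJ
  set J' := Ring.jacobson S • (⊤ : Submodule S Q) with hJ'
  obtain ⟨φ, hφ⟩ := Module.projective_lifting_property J'.mkQ (e.toLinearMap ∘ₗ J.mkQ)
    J'.mkQ_surjective
  have hφ' : ∀ x, J'.mkQ (φ x) = e (J.mkQ x) := LinearMap.congr_fun hφ
  have hsurj : LinearMap.range φ = ⊤ := by
    refine h.eq_top_of_sup_jacobson_smul_eq_top (top_unique fun y _ ↦ ?_)
    obtain ⟨x, hx⟩ := J.mkQ_surjective (e.symm (J'.mkQ y))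
    have hy : y - φ x ∈ J' := by
      refine (Submodule.Quotient.eq J').1 ?_
      change J'.mkQ y = J'.mkQ (φ x)
      rw [hφ', hx, e.apply_symm_apply]
    rw [← add_sub_cancel (φ x) y]
    exact Submodule.add_mem_sup ⟨x, rfl⟩ hy
  obtain ⟨s, hs⟩ := φ.exists_rightInverse_of_surjective hsurj
  have hs' : ∀ y, φ (s y) = y := LinearMap.congr_fun hs
  -- The kernel of `φ` lies in the radical, so the range of the section `s` is everything.
  have hs_surj : LinearMap.range s = ⊤ := by
    refine h.eq_top_of_sup_jacobson_smul_eq_top (top_unique fun x _ ↦ ?_)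
    have hx : x - s (φ x) ∈ J := by
      rw [← J.ker_mkQ, LinearMap.mem_ker, ← e.map_eq_zero_iff, ← hφ', map_sub, hs', sub_self,
        map_zero]
    rw [← add_sub_cancel (s (φ x)) x]
    exact Submodule.add_mem_sup ⟨_, rfl⟩ hx
  exact ⟨(LinearEquiv.ofBijective s
    ⟨Function.LeftInverse.injective hs', LinearMap.range_eq_top.1 hs_surj⟩).symm⟩

/-- If all simple modules are isomorphic to `T`, then a projective module whose cardinality exceeds
that of the ring is, modulo its radical, a direct sum of copies of `T` indexed by itself. -/
lemma SummandsClosedUnderChains.nonempty_quotient_equiv_finsupp (h : SummandsClosedUnderChains S)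
    {T : Type u} [AddCommGroup T] [Module S T] [IsSimpleModule S T]
    (hT : ∀ (T' : Type u) [AddCommGroup T'] [Module S T'] [IsSimpleModule S T'],
      Nonempty (T' ≃ₗ[S] T))
    {P : Type u} [AddCommGroup P] [Module S P] [Module.Projective S P] (hP : max ℵ₀ #S < #P) :
    Nonempty ((P ⧸ Ring.jacobson S • (⊤ : Submodule S P)) ≃ₗ[S] (P →₀ T)) := by
  set J := Ring.jacobson S • (⊤ : Submodule S P) with hJ
  have := h.isSemisimpleModule_quotient P
  have hiso : IsIsotypicOfType S (P ⧸ J) T := fun m _ ↦ hT m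
  obtain ⟨ι, ⟨e⟩⟩ := hiso.linearEquiv_finsupp
  have : Nontrivial T := IsSimpleModule.nontrivial S T
  obtain ⟨t, ht⟩ := exists_ne (0 : T)
  choose x hx using fun i ↦ J.mkQ_surjective (e.symm (Finsupp.single i t))
  have hspan : Submodule.span S (Set.range x) = ⊤ := by
    refine h.eq_top_of_sup_jacobson_smul_eq_top ?_
    rw [← hJ, sup_comm, ← Submodule.map_mkQ_eq_top, Submodule.map_span, ← Set.range_comp]
    refine top_unique fun y _ ↦ ?_
    rw [← e.symm_apply_apply y]
    induction e y using Finsupp.induction_linear with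
    | zero => simp
    | add f g hf hg => rw [map_add]; exact add_mem hf hg
    | single i v =>
      obtain ⟨r, rfl⟩ := IsSimpleModule.toSpanSingleton_surjective S ht v
      rw [LinearMap.toSpanSingleton_apply, ← Finsupp.smul_single, map_smul]
      exact Submodule.smul_mem _ _ (Submodule.subset_span ⟨i, hx i⟩)
  have hle : #ι ≤ #P := by
    refine Cardinal.mk_le_of_injective (f := x) fun i j hij ↦ ?_
    have := (hx i).symm.trans ((congrArg J.mkQ hij).trans (hx j))
    exact Finsupp.single_left_injective ht (e.symm.injective this)
  have hge : #P ≤ max (max ℵ₀ #S) #ι := by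
    have hsurj : Function.Surjective (Finsupp.linearCombination S x) :=
      LinearMap.range_eq_top.1 ((Finsupp.range_linearCombination S).trans hspan)
    exact (Cardinal.mk_le_of_surjective hsurj).trans (Cardinal.mk_finsupp_le_max ι S)
  obtain ⟨f⟩ := Cardinal.eq.1 (hle.antisymm ((le_max_iff.1 hge).resolve_left hP.not_ge))
  exact ⟨e.trans (Finsupp.domLCongr f)⟩

/-- Categoricity of the class of projective modules in one cardinal `κ` makes all simple modules
isomorphic: if `P` is a projective cover of a simple module `T`, then `P ^ (κ)` is isomorphic to the
free module of rank `κ`, hence has nonzero maps to every simple module, while `T` is the only simple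
image of `P`. -/
lemma SummandsClosedUnderChains.nonempty_linearEquiv_of_isSimpleModule
    (h : SummandsClosedUnderChains S) {κ : Cardinal.{u}} (hκ : max ℵ₀ #S ≤ κ)
    (hcat : ∀ (P Q : Type u) [AddCommGroup P] [Module S P] [Module.Projective S P]
      [AddCommGroup Q] [Module S Q] [Module.Projective S Q], #P = κ → #Q = κ →
        Nonempty (P ≃ₗ[S] Q))
    (T T' : Type u) [AddCommGroup T] [Module S T] [IsSimpleModule S T]
    [AddCommGroup T'] [Module S T'] [IsSimpleModule S T'] : Nonempty (T' ≃ₗ[S] T) := by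
  obtain ⟨P, _, _, _, f, hf, hsup⟩ := h.exists_projective_cover T
  have : Nontrivial T := IsSimpleModule.nontrivial S T
  have : Nontrivial T' := IsSimpleModule.nontrivial S T'
  have : Nontrivial P := hf.nontrivial
  have : Nontrivial S := Module.nontrivial S T
  have hfc : IsCoatom (LinearMap.ker f) := LinearMap.isCoatom_ker_of_surjective hf
  have hPS : #P ≤ #S := by
    obtain ⟨t, ht⟩ := exists_ne (0 : T)
    obtain ⟨x, rfl⟩ := hf t
    have hx : Submodule.span S {x} = ⊤ := by
      refine hsup _ (hfc.2 _ ((right_lt_sup).2 fun hle ↦ ht ?_))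
      exact hle (Submodule.mem_span_singleton_self x)
    refine Cardinal.mk_le_of_surjective (f := LinearMap.toSpanSingleton S P x) ?_
    rw [← LinearMap.range_eq_top, LinearMap.range_toSpanSingleton, hx]
  have hX : Infinite κ.out := by
    rw [Cardinal.infinite_iff, Cardinal.mk_out]
    exact (le_max_left _ _).trans hκ
  have : Module.Projective S (κ.out →₀ P) := by
    classical exact Module.Projective.of_equiv (finsuppLequivDFinsupp S).symm
  have hSκ : #S ≤ κ := (le_max_right _ _).trans hκ
  obtain ⟨e⟩ := hcat (κ.out →₀ P) (κ.out →₀ S)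
    (by rw [Cardinal.mk_finsupp_of_infinite, Cardinal.mk_out, max_eq_left (hPS.trans hSκ)])
    (by rw [Cardinal.mk_finsupp_of_infinite, Cardinal.mk_out, max_eq_left hSκ])
  obtain ⟨t, ht⟩ := exists_ne (0 : T')
  let g : (κ.out →₀ S) →ₗ[S] T' := Finsupp.linearCombination S fun _ ↦ t
  obtain ⟨i, hi⟩ : ∃ i, g ∘ₗ e.toLinearMap ∘ₗ Finsupp.lsingle i ≠ 0 := by
    by_contra! h0
    have h1 : g ∘ₗ e.toLinearMap = 0 := Finsupp.lhom_ext' h0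
    obtain ⟨i⟩ : Nonempty κ.out := inferInstance
    refine ht ?_
    have := LinearMap.congr_fun h1 (e.symm (Finsupp.single i 1))
    simpa [g] using this
  set φ := g ∘ₗ e.toLinearMap ∘ₗ Finsupp.lsingle i
  have hφ : Function.Surjective φ := LinearMap.surjective_of_ne_zero hi
  have hφc : IsCoatom (LinearMap.ker φ) := LinearMap.isCoatom_ker_of_surjective hφ
  have hker : LinearMap.ker φ = LinearMap.ker f := by
    by_contra hne
    exact hφc.1 (hsup _ (hφc.sup_eq_top_of_ne hfc hne))
  exact ⟨((φ.quotKerEquivOfSurjective hφ).symm.trans (Submodule.quotEquivOfEq _ _ hker)).trans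
    (f.quotKerEquivOfSurjective hf)⟩

/-- Categoricity of the class of projective modules transfers to all cardinals which exceed the
cardinality of the ring. -/
lemma SummandsClosedUnderChains.nonempty_linearEquiv_of_mk_eq
    (h : SummandsClosedUnderChains S) {κ : Cardinal.{u}} (hκ : max ℵ₀ #S ≤ κ)
    (hcat : ∀ (P Q : Type u) [AddCommGroup P] [Module S P] [Module.Projective S P]
      [AddCommGroup Q] [Module S Q] [Module.Projective S Q], #P = κ → #Q = κ →
        Nonempty (P ≃ₗ[S] Q))
    {P Q : Type u} [AddCommGroup P] [Module S P] [Module.Projective S P]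
    [AddCommGroup Q] [Module S Q] [Module.Projective S Q] (hPQ : #P = #Q) (hP : max ℵ₀ #S < #P) :
    Nonempty (P ≃ₗ[S] Q) := by
  have : Nontrivial P := Cardinal.one_lt_iff_nontrivial.1
    (Cardinal.one_lt_aleph0.trans_le ((le_max_left _ _).trans hP.le))
  have : Nontrivial S := Module.nontrivial S P
  obtain ⟨m, hm⟩ := Ideal.exists_maximal S
  have : IsSimpleModule S (S ⧸ m) := isSimpleModule_iff_isCoatom.2 hm.out
  have hT : ∀ (T' : Type u) [AddCommGroup T'] [Module S T'] [IsSimpleModule S T'],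
      Nonempty (T' ≃ₗ[S] (S ⧸ m)) := fun T' _ _ _ ↦
    h.nonempty_linearEquiv_of_isSimpleModule hκ hcat _ _
  obtain ⟨e⟩ := h.nonempty_quotient_equiv_finsupp hT hP
  obtain ⟨e'⟩ := h.nonempty_quotient_equiv_finsupp hT (hPQ ▸ hP)
  obtain ⟨f⟩ := Cardinal.eq.1 hPQ
  exact h.nonempty_linearEquiv ((e.trans (Finsupp.domLCongr f)).trans e'.symm)

end Projective

namespace RightMod

/-! ### Closure properties of roots of Ext and of abstract elementary classes -/

section AEC

variable {R : Type u} [Ring R]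

lemma projectives_subset_perpInfty (𝒞 : Set (RightMod R)) : projectives R ⊆ perpInfty 𝒞 := by
  intro M hM C _ i hi
  have : Projective M := (IsProjective.iff_projective (R := Rᵐᵒᵖ) M).1 hM
  obtain ⟨n, rfl⟩ := Nat.exists_eq_add_of_le' hi
  exact Abelian.Ext.subsingleton_of_projective M C n

lemma prod_mem_perpInfty {𝒞 : Set (RightMod R)} {M N : RightMod R} (hM : M ∈ perpInfty 𝒞)
    (hN : N ∈ perpInfty 𝒞) : ModuleCat.of Rᵐᵒᵖ (M × N) ∈ perpInfty 𝒞 := by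
  intro C hC i hi
  have := hM C hC i hi
  have := hN C hC i hi
  refine subsingleton_of_forall_eq 0 fun x ↦ ?_
  let P := ModuleCat.of Rᵐᵒᵖ (M × N)
  let f₁ : P ⟶ M := ModuleCat.ofHom (LinearMap.fst Rᵐᵒᵖ M N)
  let f₂ : P ⟶ N := ModuleCat.ofHom (LinearMap.snd Rᵐᵒᵖ M N)
  let g₁ : M ⟶ P := ModuleCat.ofHom (LinearMap.inl Rᵐᵒᵖ M N)
  let g₂ : N ⟶ P := ModuleCat.ofHom (LinearMap.inr Rᵐᵒᵖ M N)
  have hid : 𝟙 P = f₁ ≫ g₁ + f₂ ≫ g₂ :=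
    ModuleCat.hom_ext (LinearMap.ext fun x ↦ Prod.ext (add_zero _).symm (zero_add _).symm)
  rw [← Abelian.Ext.mk₀_id_comp x, hid, Abelian.Ext.mk₀_add, Abelian.Ext.add_comp,
    ← Abelian.Ext.mk₀_comp_mk₀_assoc, ← Abelian.Ext.mk₀_comp_mk₀_assoc,
    Subsingleton.elim ((Abelian.Ext.mk₀ g₁).comp x (zero_add i)) 0,
    Subsingleton.elim ((Abelian.Ext.mk₀ g₂).comp x (zero_add i)) 0]
  simp

/-- In an abstract elementary class, the union of an arbitrary chain of submodules `≺ M` is `≺ M`.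
The chain is well-ordered arbitrarily by `rk`, and the unions of the initial segments of this
well-ordering form a continuous chain. -/
lemma IsAEC.prec_sSup {𝒜 : Set (RightMod R)} {prec : SubRel R} (h : IsAEC 𝒜 prec) {M : RightMod R}
    (hbot : prec M ⊥) {c : Set (Submodule Rᵐᵒᵖ M)} (hc : IsChain (· ≤ ·) c)
    (hprec : ∀ A ∈ c, prec M A) : prec M (sSup c) := by
  let rk : Submodule Rᵐᵒᵖ M → Ordinal.{u} := Ordinal.typein WellOrderingRel
  have hrk : Function.Injective rk := Ordinal.typein_injective _
  let B : Ordinal.{u} → Submodule Rᵐᵒᵖ M := fun i ↦ sSup {A | A ∈ c ∧ rk A < i}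
  have hmono : Monotone B := fun i j hij ↦ sSup_le_sSup fun A hA ↦ ⟨hA.1, hA.2.trans_le hij⟩
  have hlim : ∀ i, Order.IsSuccLimit i → B i = ⨆ j, ⨆ _ : j < i, B j := fun i hi ↦ by
    refine le_antisymm (sSup_le fun A hA ↦ ?_) (iSup₂_le fun j hj ↦ hmono hj.le)
    exact (le_sSup ⟨hA.1, Order.lt_succ (rk A)⟩ : A ≤ B (Order.succ (rk A))).trans
      (le_iSup₂_of_le _ (hi.succ_lt hA.2) le_rfl)
  have hB : ∀ i, prec M (B i) := fun i ↦ by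
    induction i using Ordinal.limitRecOn with
    | zero =>
      have : B 0 = ⊥ := by simp [B]
      rwa [this]
    | add_one i ih =>
      rw [← Order.succ_eq_add_one]
      by_cases hi : ∃ A ∈ c, rk A = i ∧ ∀ A' ∈ c, rk A' < i → A' ≤ A
      · obtain ⟨A, hA, rfl, hle⟩ := hi
        have : B (Order.succ (rk A)) = A := by
          refine le_antisymm (sSup_le fun A' hA' ↦ ?_) (le_sSup ⟨hA, Order.lt_succ _⟩)
          obtain hlt | heq := (Order.lt_succ_iff.1 hA'.2).lt_or_eq
          · exact hle A' hA'.1 hlt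
          · exact (hrk heq).le
        rw [this]
        exact hprec A hA
      · have : B (Order.succ i) = B i := by
          refine le_antisymm (sSup_le fun A hA ↦ ?_) (hmono (Order.le_succ i))
          obtain hlt | rfl := (Order.lt_succ_iff.1 hA.2).lt_or_eq
          · exact le_sSup ⟨hA.1, hlt⟩
          · push Not at hi
            obtain ⟨A', hA', hlt, hle⟩ := hi A hA.1 rfl
            exact ((hc.total hA.1 hA').resolve_right hle).trans (le_sSup ⟨hA', hlt⟩)
        exact this ▸ ih
    | limit i hi ih =>
      rw [hlim i hi]
      refine h.union_prec M i B hi.bot_lt ⟨fun j hj ↦ (h.prec_mem _ _ (ih j hj)).1, fun j hj ↦ ?_,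
        fun j _ hj ↦ hlim j hj⟩ (h.prec_mem _ _ hbot).2 ih
      exact h.coherence M _ _ (ih j ((Order.le_succ j).trans_lt hj)) (ih _ hj)
        (hmono (Order.le_succ j))
  have : sSup c = B (Ordinal.type (WellOrderingRel (α := Submodule Rᵐᵒᵖ M))) := by
    refine congrArg sSup (Set.ext fun A ↦ ⟨fun hA ↦ ⟨hA, Ordinal.typein_lt_type _ A⟩, And.left⟩)
  exact this ▸ hB _

variable {𝒟 : Set (RightMod R)}

lemma IsAEC.extPrec_bot (h : IsAEC 𝒟 (extPrec 𝒟)) (hproj : projectives R ⊆ 𝒟) {M : RightMod R}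
    (hM : M ∈ 𝒟) : extPrec 𝒟 M ⊥ :=
  ⟨hproj (inferInstanceAs (Module.Projective Rᵐᵒᵖ (⊥ : Submodule Rᵐᵒᵖ M))), hM,
    h.iso_mem M _ ⟨(Submodule.quotEquivOfEqBot _ rfl).symm⟩ hM⟩

/-- If `(projectives R, ≺)` is an abstract elementary class, then the direct summands of projective
modules are closed under unions of chains. -/
lemma IsAEC.summandsClosedUnderChains (h : IsAEC (projectives R) (extPrec (projectives R))) :
    SummandsClosedUnderChains Rᵐᵒᵖ := by
  intro F _ _ hF c _ hc hA
  let M : RightMod R := ModuleCat.of Rᵐᵒᵖ F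
  refine (h.prec_sSup (M := M) (h.extPrec_bot subset_rfl hF) hc fun A hAc ↦ ?_).2.2
  have := hA A hAc
  obtain ⟨B, hAB⟩ := A.exists_isCompl_of_projective_quotient
  exact ⟨Module.Projective.of_split A.subtype (A.projectionOnto B hAB)
    (Submodule.projectionOnto_comp_subtype hAB), hF, this⟩

/-- An extension of `A` by a projective module `C` is isomorphic to `A × C`, and a partial
section of an epimorphism `π` extends along it. -/
lemma exists_section_extension {S : Type u} [Ring S] {M X : Type u} [AddCommGroup M]
    [Module S M] [AddCommGroup X] [Module S X] (π : X →ₗ[S] M) (hπ : Function.Surjective π)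
    {A : Submodule S M} (f : A →ₗ[S] X) (hf : ∀ x, π (f x) = x) (C : Submodule S (M ⧸ A))
    [Module.Projective S C] :
    Nonempty ((A × C) ≃ₗ[S] C.comap A.mkQ) ∧ ∃ g : C.comap A.mkQ →ₗ[S] X,
      (∀ x, g (Submodule.inclusion (A.le_comap_mkQ C) x) = f x) ∧ ∀ x, π (g x) = x := by
  let B := C.comap A.mkQ
  let q : B →ₗ[S] C := A.mkQ.restrict fun x hx ↦ hx
  have hq : Function.Surjective q := fun ⟨y, hy⟩ ↦ by
    obtain ⟨x, rfl⟩ := A.mkQ_surjective y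
    exact ⟨⟨x, hy⟩, rfl⟩
  have hqA : ∀ b : B, q b = 0 ↔ (b : M) ∈ A := fun b ↦ by
    rw [← Submodule.Quotient.mk_eq_zero A, Subtype.ext_iff]
    rfl
  obtain ⟨t, ht⟩ := q.exists_rightInverse_of_surjective (LinearMap.range_eq_top.2 hq)
  have ht' : ∀ y, q (t y) = y := LinearMap.congr_fun ht
  let i : A →ₗ[S] B := Submodule.inclusion (A.le_comap_mkQ C)
  have hi : ∀ a, q (i a) = 0 := fun a ↦ (hqA _).2 a.2
  let e : (A × C) ≃ₗ[S] B := LinearEquiv.ofBijective (i.coprod t) <| by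
    constructor
    · rw [injective_iff_map_eq_zero]
      rintro ⟨a, y⟩ h0
      rw [LinearMap.coprod_apply] at h0
      have hy : y = 0 := by
        have := congrArg q h0
        rwa [map_add, hi, ht', zero_add, map_zero] at this
      subst hy
      rw [map_zero, add_zero] at h0
      have ha : a = 0 :=
        Submodule.inclusion_injective (A.le_comap_mkQ C) (h0.trans (map_zero i).symm)
      rw [ha, Prod.mk_zero_zero]
    · intro b
      have hb : ((b - t (q b) : B) : M) ∈ A := by rw [← hqA, map_sub, ht', sub_self]
      exact ⟨(⟨_, hb⟩, q b), sub_add_cancel b (t (q b))⟩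
  have he : ∀ a y, e (a, y) = i a + t y := fun a y ↦ rfl
  obtain ⟨l, hl⟩ := Module.projective_lifting_property π (B.subtype ∘ₗ t) hπ
  let g : B →ₗ[S] X := f.coprod l ∘ₗ e.symm.toLinearMap
  have hg : ∀ a y, g (e (a, y)) = f a + l y := fun a y ↦ by
    change f.coprod l (e.symm (e (a, y))) = _
    rw [e.symm_apply_apply, LinearMap.coprod_apply]
  refine ⟨⟨e⟩, g, fun a ↦ ?_, fun b ↦ ?_⟩
  · have := hg a 0
    rwa [he, map_zero, add_zero, map_zero, add_zero] at this
  · obtain ⟨⟨a, y⟩, rfl⟩ := e.surjective b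
    rw [hg, map_add, hf, he]
    exact congrArg _ (LinearMap.congr_fun hl y)

/-- If the small modules in `𝒟` are projective, then so are all modules in `𝒟`: a maximal partial
section of a presentation of `M`, defined on a submodule `≺ M`, is defined on all of `M`, because by
the Löwenheim-Skolem property it can be extended by a small projective module. -/
lemma IsAEC.projective_of_forall_small (h : IsAEC 𝒟 (extPrec 𝒟)) (hproj : projectives R ⊆ 𝒟)
    (hprod : ∀ M ∈ 𝒟, ∀ N ∈ 𝒟, ModuleCat.of Rᵐᵒᵖ (M × N) ∈ 𝒟) {κ : Cardinal.{u}} (hκ : ℵ₀ ≤ κ)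
    (hR : #R ≤ κ) (hLS : LSProperty 𝒟 (extPrec 𝒟) κ)
    (hsmall : ∀ M ∈ 𝒟, #M ≤ κ → M ∈ projectives R) : 𝒟 ⊆ projectives R := by
  intro M hM
  let π : (M →₀ Rᵐᵒᵖ) →ₗ[Rᵐᵒᵖ] M := Finsupp.linearCombination Rᵐᵒᵖ id
  have hπ : Function.Surjective π := Finsupp.linearCombination_id_surjective _ _
  have hbot := h.extPrec_bot hproj hM
  let X := {f : M →ₗ.[Rᵐᵒᵖ] (M →₀ Rᵐᵒᵖ) | extPrec 𝒟 M f.domain ∧ ∀ x, π (f x) = x}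
  have hX : ∀ c ⊆ X, IsChain (· ≤ ·) c → ∀ f ∈ c, ∃ ub ∈ X, ∀ g ∈ c, g ≤ ub := by
    refine fun c hc hchain f hfc ↦ ⟨LinearPMap.sSup c hchain.directedOn, ⟨?_, fun x ↦ ?_⟩,
      fun g hg ↦ LinearPMap.le_sSup _ hg⟩
    · rw [LinearPMap.domain_sSup]
      refine h.prec_sSup hbot (hchain.image_of_map_rel _ _ _
        fun _ _ hle ↦ LinearPMap.domain_mono.monotone hle) ?_
      rintro _ ⟨g, hg, rfl⟩
      exact (hc hg).1
    · obtain ⟨g, hg, hxg⟩ := (LinearPMap.mem_domain_sSup_iff ⟨f, hfc⟩ hchain.directedOn).1 x.2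
      exact (congrArg π (LinearPMap.sSup_apply hchain.directedOn hg ⟨x, hxg⟩)).trans ((hc hg).2 _)
  have hbotX : ⊥ ∈ X := by
    refine ⟨hbot, fun x ↦ ?_⟩
    obtain ⟨x, hx⟩ := x
    obtain rfl : x = 0 := hx
    exact map_zero _
  obtain ⟨f, -, ⟨hfM, hf⟩, hmax⟩ := zorn_le_nonempty₀ X hX ⊥ hbotX
  suffices htop : f.domain = ⊤ by
    let s : M →ₗ[Rᵐᵒᵖ] (M →₀ Rᵐᵒᵖ) := f.toFun ∘ₗ (LinearEquiv.ofTop _ htop).symm.toLinearMap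
    exact Module.Projective.of_split s π (LinearMap.ext fun x ↦ hf _)
  by_contra htop
  obtain ⟨x, hx⟩ : ∃ x : M ⧸ f.domain, x ≠ 0 := by
    have := (Submodule.Quotient.nontrivial_iff (p := f.domain)).2 htop
    exact exists_ne 0
  obtain ⟨C, hC, hxC, ⟨-, -, hMC⟩, hcard⟩ := hLS (quot f.domain) hfM.2.2 (Submodule.span Rᵐᵒᵖ {x})
  have hspan : #(Submodule.span Rᵐᵒᵖ {x}) ≤ κ := by
    rw [← LinearMap.range_toSpanSingleton]
    refine (Cardinal.mk_le_of_surjective (LinearMap.surjective_rangeRestrict _)).trans ?_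
    rwa [Cardinal.mk_congr MulOpposite.opEquiv.symm]
  have hCproj : Module.Projective Rᵐᵒᵖ C :=
    hsmall _ hC (hcard.trans ((add_le_add_left hspan κ).trans (Cardinal.add_eq_self hκ).le))
  obtain ⟨⟨e⟩, g, hfg, hg⟩ := exists_section_extension π hπ f.toFun hf C
  have hgM : extPrec 𝒟 M (C.comap f.domain.mkQ) := by
    refine ⟨h.iso_mem _ _ ⟨e⟩ (hprod _ hfM.1 _ hC), hM, ?_⟩
    have e' := Submodule.quotientQuotientEquivQuotient f.domain (C.comap f.domain.mkQ)
      (f.domain.le_comap_mkQ C)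
    rw [Submodule.map_comap_eq_of_surjective f.domain.mkQ_surjective] at e'
    exact h.iso_mem _ _ ⟨e'⟩ hMC
  have hle : C.comap f.domain.mkQ ≤ f.domain := by
    refine (hmax (y := ⟨C.comap f.domain.mkQ, g⟩) ⟨hgM, hg⟩
      ⟨f.domain.le_comap_mkQ C, fun a b hab ↦ ?_⟩).1
    obtain rfl : Submodule.inclusion (f.domain.le_comap_mkQ C) a = b := Subtype.ext hab
    exact (hfg a).symm
  obtain ⟨y, rfl⟩ := f.domain.mkQ_surjective x
  refine hx ((Submodule.Quotient.mk_eq_zero _).2 (hle ?_))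
  exact hxC (Submodule.mem_span_singleton_self _)

end AEC

/-! ### Categoricity -/

section Categoricity

variable {R : Type u} [Ring R] {𝒟 : Set (RightMod R)} {prec : SubRel R}

lemma IsAEC.lsNumber_spec (h : IsAEC 𝒟 prec) :
    ℵ₀ ≤ LSNumber 𝒟 prec ∧ #R ≤ LSNumber 𝒟 prec ∧ LSProperty 𝒟 prec (LSNumber 𝒟 prec) := by
  obtain ⟨κ, hκ⟩ := h.exists_LS
  refine csInf_mem (s := {κ | ℵ₀ ≤ κ ∧ #R ≤ κ ∧ LSProperty 𝒟 prec κ})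
    ⟨max κ (max ℵ₀ #R), le_max_of_le_right (le_max_left _ _),
      le_max_of_le_right (le_max_right _ _), fun B hB A ↦ ?_⟩
  obtain ⟨A', h1, h2, h3, h4⟩ := hκ B hB A
  exact ⟨A', h1, h2, h3, h4.trans (add_le_add_right (le_max_left _ _) _)⟩

/-- A free module of rank `μ`. -/
lemma exists_projective_mk_eq [Nontrivial R] {μ : Cardinal.{u}} (hμ : ℵ₀ ≤ μ) (hR : #R ≤ μ) :
    ∃ M ∈ projectives R, #M = μ := by
  have : Infinite μ.out := by rwa [Cardinal.infinite_iff, Cardinal.mk_out]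
  refine ⟨ModuleCat.of Rᵐᵒᵖ (μ.out →₀ Rᵐᵒᵖ),
    inferInstanceAs (Module.Projective Rᵐᵒᵖ (μ.out →₀ Rᵐᵒᵖ)), ?_⟩
  change #(μ.out →₀ Rᵐᵒᵖ) = μ
  rw [Cardinal.mk_finsupp_of_infinite, Cardinal.mk_out,
    Cardinal.mk_congr MulOpposite.opEquiv.symm, max_eq_left hR]

lemma nontrivial_of_isCategoricalIn {μ : Cardinal.{u}} (h : IsCategoricalIn 𝒟 μ) :
    Nontrivial R := by
  obtain ⟨hμ, ⟨M, -, hM⟩, -⟩ := h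
  have : Nontrivial M := Cardinal.one_lt_iff_nontrivial.1
    (Cardinal.one_lt_aleph0.trans_le (hM ▸ hμ))
  have := Module.nontrivial Rᵐᵒᵖ M
  exact MulOpposite.opEquiv.nontrivial

/-- In a cardinal `μ ≥ #N, #R`, categoricity fails because of a free module of cardinality `μ` and
its direct sum with the non-projective module `N`, which is not projective either. -/
lemma not_isCategoricalIn_of_not_projective (hproj : projectives R ⊆ 𝒟)
    (hprod : ∀ M ∈ 𝒟, ∀ N ∈ 𝒟, ModuleCat.of Rᵐᵒᵖ (M × N) ∈ 𝒟) {N : RightMod R} (hN : N ∈ 𝒟)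
    (hN' : N ∉ projectives R) {μ : Cardinal.{u}} (hR : #R ≤ μ) (hNμ : #N ≤ μ) :
    ¬ IsCategoricalIn 𝒟 μ := by
  intro h
  have := nontrivial_of_isCategoricalIn h
  obtain ⟨F, hF, hFμ⟩ := exists_projective_mk_eq h.1 hR
  have : Module.Projective Rᵐᵒᵖ F := hF
  have hcard : #(ModuleCat.of Rᵐᵒᵖ (N × F)) = μ := by
    change #(N × F) = μ
    rw [Cardinal.mk_prod, Cardinal.lift_id, Cardinal.lift_id, hFμ]
    exact Cardinal.mul_eq_right h.1 hNμ (Cardinal.mk_ne_zero N)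
  obtain ⟨e⟩ := h.2.2 _ (hprod N hN F (hproj hF)) F (hproj hF) hcard hFμ
  have : Module.Projective Rᵐᵒᵖ (N × F) := Module.Projective.of_equiv e.symm
  exact hN' (Module.Projective.of_split (LinearMap.inl Rᵐᵒᵖ N F) (LinearMap.fst Rᵐᵒᵖ N F)
    (LinearMap.fst_comp_inl ..))

lemma isRightPerfect_of_summandsClosedUnderChains (h : SummandsClosedUnderChains Rᵐᵒᵖ) :
    IsRightPerfect R := by
  intro M
  obtain ⟨P, _, _, hP, f, hf⟩ := h.exists_projective_cover M
  exact ⟨ModuleCat.of Rᵐᵒᵖ P, hP, f, hf⟩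

lemma isCategoricalIn_projectives (h : SummandsClosedUnderChains Rᵐᵒᵖ) {κ μ : Cardinal.{u}}
    (hκ : #R ≤ κ) (hcat : IsCategoricalIn (projectives R) κ) (hμ₀ : ℵ₀ < μ) (hμ : #R < μ) :
    IsCategoricalIn (projectives R) μ := by
  have := nontrivial_of_isCategoricalIn hcat
  have hop : #Rᵐᵒᵖ = #R := Cardinal.mk_congr MulOpposite.opEquiv.symm
  refine ⟨hμ₀.le, exists_projective_mk_eq hμ₀.le hμ.le, fun M hM N hN hMμ hNμ ↦ ?_⟩
  have : Module.Projective Rᵐᵒᵖ M := hM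
  have : Module.Projective Rᵐᵒᵖ N := hN
  refine h.nonempty_linearEquiv_of_mk_eq (κ := κ) (max_le hcat.1 (hop.trans_le hκ))
    (fun P Q _ _ hP _ _ hQ hPκ hQκ ↦ hcat.2.2 (ModuleCat.of Rᵐᵒᵖ P) hP (ModuleCat.of Rᵐᵒᵖ Q) hQ
      hPκ hQκ) (hMμ.trans hNμ.symm) ?_
  rw [hMμ, hop]
  exact max_lt hμ₀ hμ

lemma succ_le_beth_succ_two_power (κ : Cardinal.{u}) :
    Order.succ κ ≤ ℶ_ (Order.succ ((2 : Cardinal.{u}) ^ κ)).ord :=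
  (Order.succ_le_succ (Cardinal.cantor κ).le).trans (Cardinal.le_beth_ord _)

end Categoricity

end RightMod

theorem theorem2p3 (R : Type u) [Ring R] (𝒟 : Set (RightMod R)) (prec : RightMod.SubRel R)
    (h : RightMod.IsAECOfRootsOfExt 𝒟 prec) :
    RightMod.SCC 𝒟 prec ∧
    RightMod.CategoricityTransfer 𝒟 (Order.succ (RightMod.LSNumber 𝒟 prec)) ∧
    (((∃ M ∈ 𝒟, M ∉ RightMod.projectives R) ∧
        ∀ μ, RightMod.LSNumber 𝒟 prec ≤ μ → ¬ RightMod.IsCategoricalIn 𝒟 μ) ∨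
      (𝒟 = RightMod.projectives R ∧ RightMod.IsRightPerfect R ∧
        ((∃ μ, RightMod.LSNumber 𝒟 prec ≤ μ ∧ RightMod.IsCategoricalIn 𝒟 μ) →
          ∀ μ, Order.succ (RightMod.LSNumber 𝒟 prec) ≤ μ → RightMod.IsCategoricalIn 𝒟 μ))) := by
  obtain ⟨⟨𝒞, rfl⟩, rfl, hA⟩ := h
  set 𝒟 := RightMod.perpInfty 𝒞
  have hproj : RightMod.projectives R ⊆ 𝒟 := RightMod.projectives_subset_perpInfty 𝒞
  have hprod : ∀ M ∈ 𝒟, ∀ N ∈ 𝒟, ModuleCat.of Rᵐᵒᵖ (M × N) ∈ 𝒟 :=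
    fun M hM N hN ↦ RightMod.prod_mem_perpInfty hM hN
  obtain ⟨hρ, hR, hLS⟩ := hA.lsNumber_spec
  set ρ := RightMod.LSNumber 𝒟 (RightMod.extPrec 𝒟)
  have main : ((∃ M ∈ 𝒟, M ∉ RightMod.projectives R) ∧
        ∀ μ, ρ ≤ μ → ¬ RightMod.IsCategoricalIn 𝒟 μ) ∨
      (𝒟 = RightMod.projectives R ∧ RightMod.IsRightPerfect R ∧
        ((∃ μ, ρ ≤ μ ∧ RightMod.IsCategoricalIn 𝒟 μ) →
          ∀ μ, Order.succ ρ ≤ μ → RightMod.IsCategoricalIn 𝒟 μ)) := by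
    by_cases hsmall : ∀ M ∈ 𝒟, #M ≤ ρ → M ∈ RightMod.projectives R
    · right
      have heq : 𝒟 = RightMod.projectives R :=
        (hA.projective_of_forall_small hproj hprod hρ hR hLS hsmall).antisymm hproj
      have hchain : SummandsClosedUnderChains Rᵐᵒᵖ := by
        rw [heq] at hA
        exact hA.summandsClosedUnderChains
      refine ⟨heq, RightMod.isRightPerfect_of_summandsClosedUnderChains hchain, ?_⟩
      rintro ⟨κ, hκ, hcat⟩ μ hμ
      rw [heq] at hcat ⊢
      have hμ' : ρ < μ := Order.succ_le_iff.1 hμ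
      exact RightMod.isCategoricalIn_projectives hchain (hR.trans hκ) hcat (hρ.trans_lt hμ')
        (hR.trans_lt hμ')
    · left
      push Not at hsmall
      obtain ⟨N, hN, hNρ, hN'⟩ := hsmall
      exact ⟨⟨N, hN, hN'⟩, fun μ hμ ↦ RightMod.not_isCategoricalIn_of_not_projective hproj hprod hN
        hN' (hR.trans hμ) (hNρ.trans hμ)⟩
  have transfer : ∀ θ, Order.succ ρ ≤ θ → RightMod.CategoricityTransfer 𝒟 θ := by
    rintro θ hθ ⟨κ, hκ, hcat⟩ μ hμ
    have hρκ : ρ ≤ κ := (Order.le_succ ρ).trans (hθ.trans hκ)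
    obtain ⟨-, hno⟩ | ⟨-, -, hyes⟩ := main
    · exact absurd hcat (hno κ hρκ)
    · exact hyes ⟨κ, hρκ, hcat⟩ μ (hθ.trans hμ)
  exact ⟨transfer _ (RightMod.succ_le_beth_succ_two_power ρ), transfer _ le_rfl, main⟩
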